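/- Let $0<q<1$, let $N,n,k$ be integers with $1\le k\le n-1$ and $n\le N$, and let $\alpha,\beta,\gamma,\delta$ be real. Write $(a;q)_m=\prod_{j=0}^{m-1}(1-aq^j)$, $(a_1,\dots,a_r;q)_m=\prod_i (a_i;q)_m$, $\mu(x)=q^{-x}+\gamma\delta q^{x+1}$, let $$w(x)=\frac{(\alpha q,\beta\delta q,\gamma q,\gamma\delta q;q)_x\,(1-\gamma\delta q^{2x+1})}{\big(q,\tfrac{\gamma\delta q}{\alpha},\tfrac{\gamma q}{\beta},\delta q;q\big)_x(\alpha\beta q)^x(1-\gamma\delta q)},\qquad x\in\{0,1,\dots,N\},$$ and let $\tilde R_n(\,\cdot\,;\alpha,\beta,\gamma,\delta|q)$ be the monic $q$-Racah polynomial, i.e. the polynomial of degree $n$ in the variable $\mu(x)$ given by $$\tilde R_n(\mu(x);\alpha,\beta,\gamma,\delta|q)=\frac{(\alpha q,\beta\delta q,\gamma q;q)_n}{(\alpha\beta q^{n+1};q)_n}\sum_{m=0}^{n}\frac{(q^{-n},\alpha\beta q^{n+1},q^{-x},\gamma\delta q^{x+1};q)_m}{(\alpha q,\beta\delta q,\gamma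 q,q;q)_m}\,q^m .$$ Consider the two cases (i) $\alpha=q^{-N-1}$ and $Q(y)=\tilde R_n\big(y;\tfrac{\alpha}{q^k},\beta,\gamma,\delta|q\big)$; (ii) $\delta\ne0$, $\beta=\dfrac{q^{-N-1}}{\delta}$ and $Q(y)=\tilde R_n\big(y;\alpha,\tfrac{\beta}{q^k},\gamma,\delta|q\big)$. Assume that the points $\mu(0),\dots,\mu(N)$ are distinct, that $w(0),\dots,w(N)$ (formed with the unshifted parameters) are well defined and nonzero, and that $\alpha\beta q^j\neq1$ for $2\le j\le 2N$ (so that all polynomials involved are well defined). Then in each of the two cases: (a) $Q$ has exact degree $n$ and $\sum_{x=0}^{N}\mu(x)^mQ(\mu(x))w(x)=0$ for all $m\in\{0,1,\dots,n-k-1\}$. If moreover $\beta q^n\ne1$ in case (i), respectively $\alpha q^n\neq\delta$ in case (ii), then $\sum_{x=0}^{N}\mu(x)^{n-k}Q(\mu(x))w(x)\neq0$, so that $Q$ is discrete quasi-orthogonal of order exactly $k$ with respect to the weight $w$ on $\{\mu(0),\dots,\mu(N)\}$. (b) If moreover $w(x)>0$ for $x\in\{0,\dots,N\}$ and $\mu(0)<\mu(1)<\dots<\mu(N)$,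 then $Q$ has at least $n-k$ distinct real zeros in the open interval $(\mu(0),\mu(N))$. -/

import Mathlib

open Polynomial

/-- The `q`-Pochhammer symbol `(a; q)_m = ∏_{j < m} (1 - a q^j)`. -/
noncomputable def qPoch (a q : ℝ) (m : ℕ) : ℝ :=
  ∏ j ∈ Finset.range m, (1 - a * q ^ j)

/-- The lattice `μ(x) = q^{-x} + γ δ q^{x+1}` at the nonnegative integers. -/
noncomputable def qRacahNode (q γ δ : ℝ) (x : ℕ) : ℝ :=
  (q ^ x)⁻¹ + γ * δ * q ^ (x + 1)

/-- The `q`-Racah weight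
`(αq, βδq, γq, γδq; q)_x (1 - γδq^{2x+1}) /
  ((q, γδq/α, γq/β, δq; q)_x (αβq)^x (1 - γδq))`. -/
noncomputable def qRacahWeight (q α β γ δ : ℝ) (x : ℕ) : ℝ :=
  (qPoch (α * q) q x * qPoch (β * δ * q) q x * qPoch (γ * q) q x * qPoch (γ * δ * q) q x
      * (1 - γ * δ * q ^ (2 * x + 1))) /
    (qPoch q q x * qPoch (γ * δ * q / α) q x * qPoch (γ * q / β) q x * qPoch (δ * q) q x
      * (α * β * q) ^ x * (1 - γ * δ * q))

/-- The basis polynomial `∏_{j < m} (1 - q^j y + γδ q^{2j+1})` in the lattice variable `y`;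
at `y = q^{-x} + γδ q^{x+1}` it equals `(q^{-x}; q)_m (γδ q^{x+1}; q)_m`. -/
noncomputable def qRacahBasis (q γ δ : ℝ) (m : ℕ) : ℝ[X] :=
  ∏ j ∈ Finset.range m, (C (1 + γ * δ * q ^ (2 * j + 1)) - C (q ^ j) * X)

/-- The monic `q`-Racah polynomial of degree `n`, as a polynomial in the lattice variable:
`(αq, βδq, γq; q)_n / (αβq^{n+1}; q)_n` times the terminating `₄φ₃` series. -/
noncomputable def qRacahPoly (q : ℝ) (n : ℕ) (α β γ δ : ℝ) : ℝ[X] :=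
  C (qPoch (α * q) q n * qPoch (β * δ * q) q n * qPoch (γ * q) q n
      / qPoch (α * β * q ^ (n + 1)) q n) *
    ∑ m ∈ Finset.range (n + 1),
      C (qPoch ((q ^ n)⁻¹) q m * qPoch (α * β * q ^ (n + 1)) q m
          / (qPoch (α * q) q m * qPoch (β * δ * q) q m * qPoch (γ * q) q m * qPoch q q m)
          * q ^ m) * qRacahBasis q γ δ m

theorem qRacahBasis_eval (q γ δ t : ℝ) (ht : t ≠ 0) (m : ℕ) :
    (qRacahBasis q γ δ m).eval (t + γ * δ * q / t)
      = qPoch t q m * qPoch (γ * δ * q / t) q m := by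
  unfold qRacahBasis qPoch
  rw [eval_prod, ← Finset.prod_mul_distrib]
  refine Finset.prod_congr rfl fun j _ => ?_
  simp only [eval_sub, eval_mul, eval_C, eval_X]
  field_simp
  ring

/-- With `t = q^{-x}` (so that `t + γδq/t = μ(x)`), the polynomial takes the values given by the
`₄φ₃` formula. -/
theorem qRacahPoly_eval (q : ℝ) (n : ℕ) (α β γ δ t : ℝ) (ht : t ≠ 0) :
    (qRacahPoly q n α β γ δ).eval (t + γ * δ * q / t)
      = qPoch (α * q) q n * qPoch (β * δ * q) q n * qPoch (γ * q) q n
          / qPoch (α * β * q ^ (n + 1)) q n *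
        ∑ m ∈ Finset.range (n + 1),
          qPoch ((q ^ n)⁻¹) q m * qPoch (α * β * q ^ (n + 1)) q m * qPoch t q m
              * qPoch (γ * δ * q / t) q m
            / (qPoch (α * q) q m * qPoch (β * δ * q) q m * qPoch (γ * q) q m)
            * (q ^ m / qPoch q q m) := by
  unfold qRacahPoly
  rw [eval_mul, eval_C, eval_finsetSum]
  congr 1
  refine Finset.sum_congr rfl fun m _ => ?_
  rw [eval_mul, eval_C, qRacahBasis_eval q γ δ t ht]
  simp only [div_eq_mul_inv, mul_inv]
  ring

/-- The `m`-th moment `∑_{x=0}^{N} μ(x)^m Q(μ(x)) w(x)` of a polynomial `Q`. -/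
noncomputable def discreteMoment (N : ℕ) (μ w : ℕ → ℝ) (Q : ℝ[X]) (m : ℕ) : ℝ :=
  ∑ x ∈ Finset.range (N + 1), μ x ^ m * Q.eval (μ x) * w x

/-- `Q` has exact degree `n`, and its moments of order `0, …, n - k - 1` vanish. -/
structure IsWeakQuasiOrthogonal (N : ℕ) (μ w : ℕ → ℝ) (n k : ℕ) (Q : ℝ[X]) : Prop where
  natDegree_eq : Q.natDegree = n
  moment_eq_zero : ∀ m : ℕ, m + k < n → discreteMoment N μ w Q m = 0

/-- Discrete quasi-orthogonality of order (exactly) `k`: in addition, the moment of order `n - k`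
does not vanish. -/
structure IsDiscreteQuasiOrthogonal (N : ℕ) (μ w : ℕ → ℝ) (n k : ℕ) (Q : ℝ[X]) : Prop
    extends IsWeakQuasiOrthogonal N μ w n k Q where
  order_le : k ≤ n
  moment_ne_zero : discreteMoment N μ w Q (n - k) ≠ 0

/-- The number of distinct real zeros of `Q` in the open interval `(a, b)`. -/
noncomputable def numZerosIoo (Q : ℝ[X]) (a b : ℝ) : ℕ :=
  Set.ncard {y : ℝ | y ∈ Set.Ioo a b ∧ Q.IsRoot y}

/-- The `q`-Racah data on `{0, …, N}` are admissible: the nodes are distinct, the weight is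
defined and nonzero at each node (a vanishing denominator gives the value `0` here, so it is
excluded), and the denominators `(αβq^{m+1}; q)_m`, `m ≤ N`, do not vanish. -/
structure QRacahAdmissible (q : ℝ) (N : ℕ) (α β γ δ : ℝ) : Prop where
  node_injOn : Set.InjOn (qRacahNode q γ δ) (Set.Iic N)
  weight_ne_zero : ∀ x ≤ N, qRacahWeight q α β γ δ x ≠ 0
  param_ne : ∀ j : ℕ, 2 ≤ j → j ≤ 2 * N → α * β * q ^ j ≠ 1

/-- The weight is positive at every node, and `μ(0) < μ(1) < ⋯ < μ(N)`. -/
structure QRacahPositive (q : ℝ) (N : ℕ) (α β γ δ : ℝ) : Prop where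
  weight_pos : ∀ x ≤ N, 0 < qRacahWeight q α β γ δ x
  node_lt : ∀ x < N, qRacahNode q γ δ x < qRacahNode q γ δ (x + 1)

/-!
Let `α = q^{-N-1}`, let `L` be the functional `P ↦ ∑_{x ≤ N} P(μ(x)) w(x)`, and let `ψ_s` be the
monic polynomial vanishing at the top nodes `μ(s + 1), …, μ(N)`. The Pearson equation of the weight
makes a suitable combination of the terms of `L(φ_{m+1} ψ_s)` and `L(φ_m ψ_s)` telescope, where
`φ_m` is the basis polynomial with `φ_m(μ(x)) = (q^{-x}, γδq^{x+1}; q)_m`. The resulting two-term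
recurrence in `m` evaluates `L(φ_m ψ_s)`, and the `q`-Saalschütz formula then gives, for an
arbitrary first parameter `a` of the polynomial,
`L(ψ_s R̃_n(·; a, β, γ, δ)) = c (βq; q)_n (a q^{s+1}; q)_n L(ψ_s)` with `c ≠ 0`.
For `a = α / q^k` and `s = N - l` the factor `(a q^{s+1}; q)_n` is `(q^{-k-l}; q)_n`, which vanishes
exactly when `k + l < n`. Since `ψ_{N-l}` is monic of degree `l`, this is quasi-orthogonality of
order `k`. Zeros in the open interval are produced by the usual sign-change argument, and case (ii)
reduces to case (i) by the symmetry `(α, βδ) ↦ (βδ, α)`.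
-/

section QPochhammer

theorem qPoch_zero (a q : ℝ) : qPoch a q 0 = 1 := Finset.prod_range_zero _

theorem qPoch_succ (a q : ℝ) (m : ℕ) : qPoch a q (m + 1) = qPoch a q m * (1 - a * q ^ m) :=
  Finset.prod_range_succ _ m

theorem qPoch_succ' (a q : ℝ) (m : ℕ) : qPoch a q (m + 1) = (1 - a) * qPoch (a * q) q m := by
  simp only [qPoch, Finset.prod_range_succ', pow_zero, mul_one, mul_comm (1 - a), pow_succ',
    mul_assoc]

theorem qPoch_ne_zero_iff {a q : ℝ} {m : ℕ} : qPoch a q m ≠ 0 ↔ ∀ j < m, a * q ^ j ≠ 1 := by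
  simp only [qPoch, Finset.prod_ne_zero_iff, Finset.mem_range, sub_ne_zero, ne_comm (a := (1 : ℝ))]

theorem qPoch_ne_zero_of_le {a q : ℝ} {m n : ℕ} (hmn : m ≤ n) (h : qPoch a q n ≠ 0) :
    qPoch a q m ≠ 0 :=
  qPoch_ne_zero_iff.2 fun j hj => qPoch_ne_zero_iff.1 h j (hj.trans_le hmn)

theorem qPoch_eq_zero {a q : ℝ} {m j : ℕ} (hj : j < m) (h : a * q ^ j = 1) : qPoch a q m = 0 :=
  Finset.prod_eq_zero (Finset.mem_range.2 hj) (by rw [h, sub_self])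

theorem qPoch_inv_pow_ne_zero {q : ℝ} (hq : q ≠ 0) {n : ℕ} (hqn : qPoch q q n ≠ 0) :
    qPoch (q ^ n)⁻¹ q n ≠ 0 := by
  refine qPoch_ne_zero_iff.2 fun j hj h => qPoch_ne_zero_iff.1 hqn (n - 1 - j) (by lia) ?_
  rw [← pow_succ', show n - 1 - j + 1 = n - j by lia, pow_sub₀ q hq hj.le,
    ← inv_inv (q ^ n * _), mul_inv, inv_inv, h, inv_one]

end QPochhammer

section Saalschutz

/-- The `m`-th term of the terminating series
`₃φ₂(q^{-n}, e q^n, a; c, d; q, q)`; it is balanced when `c d = q e a`. -/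
noncomputable def saalschutzTerm (q a c d e : ℝ) (n m : ℕ) : ℝ :=
  qPoch (q ^ n)⁻¹ q m * qPoch (e * q ^ n) q m * qPoch a q m
    / (qPoch c q m * qPoch d q m * qPoch q q m) * q ^ m

variable {q a c d e : ℝ}

-- The certificate on the right comes from the `q`-Zeilberger algorithm in `n`.
theorem sum_saalschutzTerm_succ_sub (hq : q ≠ 0) (ha : a ≠ 0) (hbal : c * d = q * e * a)
    (n : ℕ) {M : ℕ} (hc : qPoch c q M ≠ 0) (hd : qPoch d q M ≠ 0) (hqM : qPoch q q M ≠ 0) :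
    ∑ m ∈ Finset.range (M + 1),
      ((1 - c * q ^ n) * (1 - d * q ^ n) * saalschutzTerm q a c d e (n + 1) m
        - a * (1 - c / a * q ^ n) * (1 - d / a * q ^ n) * saalschutzTerm q a c d e n m)
      = (1 - e * q ^ (2 * n + 1)) * (qPoch (q ^ n)⁻¹ q M * qPoch (e * q ^ (n + 1)) q M
          * qPoch a q (M + 1) / (qPoch c q M * qPoch d q M * qPoch q q M)) := by
  have hqn : q ^ n ≠ 0 := pow_ne_zero n hq
  obtain rfl : e = c * d / (q * a) := by field_simp; linear_combination -hbal
  induction M with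
  | zero =>
    simp only [saalschutzTerm, zero_add, Finset.sum_range_one, qPoch_zero, qPoch_succ]
    field_simp
    ring
  | succ M ih =>
    have shift_inv : qPoch (q ^ (n + 1))⁻¹ q (M + 1)
        = (1 - (q ^ (n + 1))⁻¹) * qPoch (q ^ n)⁻¹ q M := by
      rw [qPoch_succ', pow_succ, mul_inv, inv_mul_cancel_right₀ hq]
    have shift_e (e : ℝ) :
        qPoch (e * q ^ n) q (M + 1) = (1 - e * q ^ n) * qPoch (e * q ^ (n + 1)) q M := by
      rw [qPoch_succ', pow_succ, mul_assoc]
    simp only [qPoch_succ, mul_ne_zero_iff] at hc hd hqM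
    obtain ⟨⟨hc, hcM⟩, ⟨hd, hdM⟩, ⟨hqM, hqM'⟩⟩ := And.intro hc (And.intro hd hqM)
    rw [Finset.sum_range_succ, ih hc hd hqM, saalschutzTerm, saalschutzTerm, shift_inv, shift_e]
    simp only [qPoch_succ _ _ (M + 1), qPoch_succ _ _ M]
    generalize qPoch c q M = pc at *
    generalize qPoch d q M = pd at *
    generalize qPoch q q M = pq at *
    rw [show q ^ (2 * n + 1) = q ^ n * q ^ n * q by ring, pow_succ q n, pow_succ q M]
    generalize q ^ n = x at *
    generalize q ^ M = y at *
    field_simp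
    ring

theorem sum_saalschutzTerm (hq : q ≠ 0) (ha : a ≠ 0) (hbal : c * d = q * e * a) {n : ℕ}
    (hc : qPoch c q n ≠ 0) (hd : qPoch d q n ≠ 0) (hqn : qPoch q q n ≠ 0) :
    ∑ m ∈ Finset.range (n + 1), saalschutzTerm q a c d e n m
      = a ^ n * qPoch (c / a) q n * qPoch (d / a) q n / (qPoch c q n * qPoch d q n) := by
  induction n with
  | zero => simp [saalschutzTerm, qPoch_zero]
  | succ n ih =>
    have hz : qPoch (q ^ n)⁻¹ q (n + 1) = 0 :=
      qPoch_eq_zero n.lt_succ_self (inv_mul_cancel₀ (pow_ne_zero n hq))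
    have hlast : saalschutzTerm q a c d e n (n + 1) = 0 := by simp [saalschutzTerm, hz]
    have key := sum_saalschutzTerm_succ_sub hq ha hbal n hc hd hqn
    rw [hz, Finset.sum_sub_distrib, ← Finset.mul_sum, ← Finset.mul_sum,
      Finset.sum_range_succ (saalschutzTerm q a c d e n), hlast,
      ih (qPoch_ne_zero_of_le n.le_succ hc) (qPoch_ne_zero_of_le n.le_succ hd)
        (qPoch_ne_zero_of_le n.le_succ hqn)] at key
    simp only [zero_mul, mul_zero, zero_div, add_zero, sub_eq_zero] at key
    simp only [qPoch_succ _ _ n, mul_ne_zero_iff] at hc hd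
    rw [eq_div_of_mul_eq (mul_ne_zero hc.2 hd.2) ((mul_comm _ _).trans key),
      mul_div_assoc', div_div]
    simp only [qPoch_succ]
    congr 1 <;> ring

end Saalschutz

section LinearFunctional

variable {R M : Type*} [CommRing R] [AddCommGroup M] [Module R M]

theorem map_eq_zero_of_monic_of_degree_lt (L : R[X] →ₗ[R] M) {p : ℕ → R[X]} {d : ℕ}
    (hmonic : ∀ i < d, (p i).Monic) (hdeg : ∀ i < d, (p i).natDegree = i)
    (hL : ∀ i < d, L (p i) = 0) {P : R[X]} (hP : P.degree < d) : L P = 0 := by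
  induction d generalizing P with
  | zero =>
    rw [degree_lt_iff_coeff_zero] at hP
    rw [show P = 0 from ext fun m => hP m m.zero_le, map_zero]
  | succ d ih =>
    have hlead : (p d).coeff d = 1 := by
      rw [← hmonic d d.lt_succ_self, leadingCoeff, hdeg d d.lt_succ_self]
    have hlt : (P - P.coeff d • p d).degree < d := by
      rw [degree_lt_iff_coeff_zero] at hP ⊢
      intro m hm
      rcases hm.eq_or_lt with rfl | hm
      · simp [hlead]
      · have hpm : (p d).coeff m = 0 :=
          coeff_eq_zero_of_natDegree_lt (by rwa [hdeg d d.lt_succ_self])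
        simp [hP m hm, hpm]
    have hrest := ih (fun i hi => hmonic i (by lia)) (fun i hi => hdeg i (by lia))
      (fun i hi => hL i (by lia)) hlt
    rwa [map_sub, map_smul, hL d d.lt_succ_self, smul_zero, sub_zero] at hrest

theorem map_X_pow_eq_map_monic (L : R[X] →ₗ[R] M) {p : R[X]} (hp : p.Monic)
    (hL : ∀ P : R[X], P.degree < p.natDegree → L P = 0) : L (X ^ p.natDegree) = L p := by
  rcases subsingleton_or_nontrivial R
  · rw [Subsingleton.elim (X ^ p.natDegree) p]
  rw [← sub_eq_zero, ← map_sub]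
  refine hL _ ((degree_sub_lt_left ?_ (monic_X_pow _).ne_zero ?_).trans_eq (degree_X_pow _))
  · rw [degree_X_pow, degree_eq_natDegree hp.ne_zero]
  · rw [leadingCoeff_X_pow, hp.leadingCoeff]

end LinearFunctional

section MomentFunctional

/-- The linear functional `P ↦ ∑_{x ≤ N} P(μ(x)) w(x)` attached to a discrete weight. -/
noncomputable def momentFunctional (N : ℕ) (μ w : ℕ → ℝ) : ℝ[X] →ₗ[ℝ] ℝ :=
  ∑ x ∈ Finset.range (N + 1), w x • leval (μ x)

variable {N : ℕ} {μ w : ℕ → ℝ}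

theorem momentFunctional_apply (P : ℝ[X]) :
    momentFunctional N μ w P = ∑ x ∈ Finset.range (N + 1), P.eval (μ x) * w x := by
  simp [momentFunctional, mul_comm]

theorem discreteMoment_eq_momentFunctional (Q : ℝ[X]) (m : ℕ) :
    discreteMoment N μ w Q m = momentFunctional N μ w (X ^ m * Q) := by
  simp [discreteMoment, momentFunctional_apply]

theorem eval_eq_zero_of_momentFunctional_eq_zero (hw : ∀ x ≤ N, 0 < w x) {P : ℝ[X]}
    (hP : ∀ x ≤ N, 0 ≤ P.eval (μ x)) (h : momentFunctional N μ w P = 0) {x : ℕ} (hx : x ≤ N) :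
    P.eval (μ x) = 0 := by
  rw [momentFunctional_apply, Finset.sum_eq_zero_iff_of_nonneg fun y hy =>
    mul_nonneg (hP y (Finset.mem_range_succ_iff.1 hy)) (hw y (Finset.mem_range_succ_iff.1 hy)).le]
    at h
  exact (mul_eq_zero.1 (h x (Finset.mem_range_succ_iff.2 hx))).resolve_right (hw x hx).ne'

end MomentFunctional

section Zeros

theorem exists_mul_eval_nonneg_of_forall_not_isRoot {a b : ℝ} (hab : a < b) {Q : ℝ[X]}
    (hQ : ∀ z ∈ Set.Ioo a b, ¬Q.IsRoot z) :
    ∃ s ≠ 0, ∀ y ∈ Set.Icc a b, 0 ≤ s * Q.eval y := by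
  obtain ⟨c, hc⟩ := Set.nonempty_Ioo.2 hab
  refine ⟨Q.eval c, hQ c hc, fun y hy => ?_⟩
  by_contra! hneg
  obtain ⟨t, ht, ht0⟩ := intermediate_value_uIcc (f := fun y => Q.eval c * Q.eval y) (a := y)
    (b := c) (by fun_prop) (Set.mem_uIcc.2 (.inl ⟨hneg.le, mul_self_nonneg _⟩))
  have hty : t ≠ y := by rintro rfl; exact hneg.ne ht0
  refine hQ t ?_ ((mul_eq_zero.1 ht0).resolve_left (hQ c hc))
  rcases Set.mem_uIcc.1 ht with ⟨hyt, htc⟩ | ⟨hct, hty'⟩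
  · exact ⟨hy.1.trans_lt (hyt.lt_of_ne' hty), htc.trans_lt hc.2⟩
  · exact ⟨hc.1.trans_le hct, (hty'.lt_of_ne hty).trans_le hy.2⟩

theorem exists_finset_roots_mul_prod_nonneg {a b : ℝ} (hab : a < b) {Q : ℝ[X]} (hQ : Q ≠ 0) :
    ∃ (Z : Finset ℝ) (s : ℝ), s ≠ 0 ∧ (∀ z ∈ Z, z ∈ Set.Ioo a b ∧ Q.IsRoot z) ∧
      ∀ y ∈ Set.Icc a b, 0 ≤ s * (Q * ∏ z ∈ Z, (X - C z)).eval y := by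
  induction hn : Q.natDegree generalizing Q with
  | zero =>
    obtain ⟨c, rfl⟩ := natDegree_eq_zero.1 hn
    exact ⟨∅, c, by simpa using hQ, by simp, fun y _ => by simpa using mul_self_nonneg c⟩
  | succ n ih =>
    by_cases h : ∃ z ∈ Set.Ioo a b, Q.IsRoot z
    · obtain ⟨z, hz, hroot⟩ := h
      obtain ⟨R, rfl⟩ := dvd_iff_isRoot.2 hroot
      have hR : R ≠ 0 := right_ne_zero_of_mul hQ
      rw [natDegree_mul (X_sub_C_ne_zero z) hR, natDegree_X_sub_C] at hn
      obtain ⟨Z, s, hs, hZ, hnonneg⟩ := ih hR (by lia)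
      have hZ' : ∀ y ∈ Z, y ∈ Set.Ioo a b ∧ ((X - C z) * R).IsRoot y := fun y hy =>
        ⟨(hZ y hy).1, root_mul_left_of_isRoot _ (hZ y hy).2⟩
      by_cases hzZ : z ∈ Z
      · refine ⟨Z.erase z, s, hs, fun y hy => hZ' y (Finset.mem_of_mem_erase hy), ?_⟩
        rwa [mul_comm _ R, mul_assoc, Finset.mul_prod_erase Z (X - C ·) hzZ]
      · refine ⟨insert z Z, s, hs, Finset.forall_mem_insert _ _ _ |>.2 ⟨⟨hz, hroot⟩, hZ'⟩,
          fun y hy => ?_⟩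
        have hsq := mul_nonneg (sq_nonneg (y - z)) (hnonneg y hy)
        rw [Finset.prod_insert hzZ]
        simp only [eval_mul, eval_sub, eval_X, eval_C] at hsq ⊢
        linear_combination hsq
    · push Not at h
      obtain ⟨s, hs, hnonneg⟩ := exists_mul_eval_nonneg_of_forall_not_isRoot hab h
      exact ⟨∅, s, hs, by simp, by simpa using hnonneg⟩

theorem le_numZerosIoo_of_orthogonal {N d : ℕ} {μ w : ℕ → ℝ} {Q : ℝ[X]} (hN : 0 < N)
    (hQ : Q ≠ 0) (hQN : Q.natDegree ≤ N) (hμ : StrictMonoOn μ (Set.Iic N))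
    (hw : ∀ x ≤ N, 0 < w x)
    (horth : ∀ P : ℝ[X], P.degree < d → momentFunctional N μ w (P * Q) = 0) :
    d ≤ numZerosIoo Q (μ 0) (μ N) := by
  obtain ⟨Z, s, hs, hZ, hnonneg⟩ := exists_finset_roots_mul_prod_nonneg
    (hμ (Set.mem_Iic.2 N.zero_le) Set.self_mem_Iic hN) hQ
  have hcard : Z.card ≤ numZerosIoo Q (μ 0) (μ N) := by
    rw [numZerosIoo, ← Set.ncard_coe_finset]
    exact Set.ncard_le_ncard hZ ((finite_setOfPred_isRoot hQ).subset fun y hy => hy.2)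
  refine le_trans ?_ hcard
  by_contra! hlt
  have hzero : momentFunctional N μ w (C s * (Q * ∏ z ∈ Z, (X - C z))) = 0 := by
    rw [mul_comm Q, ← smul_eq_C_mul, map_smul, horth _ ?_, smul_zero]
    simpa [degree_prod] using hlt
  refine hQ (eq_zero_of_degree_lt_of_eval_index_eq_zero (s := Finset.Iic N)
    (v := μ) (by simpa using hμ.injOn) ?_ fun x hx => ?_)
  · rw [Nat.card_Iic]
    exact (degree_le_of_natDegree_le hQN).trans_lt (mod_cast N.lt_succ_self)
  · rw [Finset.mem_Iic] at hx
    have hprod := eval_eq_zero_of_momentFunctional_eq_zero hw (fun y hy => ?_) hzero hx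
    · rw [eval_mul, eval_C, eval_mul] at hprod
      refine ((mul_eq_zero.1 hprod).resolve_left hs |> mul_eq_zero.1).elim id fun hxZ => ?_
      rw [eval_prod, Finset.prod_eq_zero_iff] at hxZ
      obtain ⟨z, hz, hxz⟩ := hxZ
      obtain rfl : μ x = z := by simpa [sub_eq_zero] using hxz
      exact (hZ _ hz).2
    · rw [eval_mul, eval_C]
      exact hnonneg _ ⟨hμ.monotoneOn (by simp) hy y.zero_le, hμ.monotoneOn hy (by simp) hy⟩

end Zeros

section Nodes

variable {q : ℝ} (γ δ : ℝ)

theorem qRacahNode_sub (hq : q ≠ 0) (x y : ℕ) :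
    qRacahNode q γ δ x - qRacahNode q γ δ y
      = ((q ^ x)⁻¹ - (q ^ y)⁻¹) * (1 - γ * δ * q ^ (x + y + 1)) := by
  rw [qRacahNode, qRacahNode]
  field_simp
  ring

variable (q) in
/-- The monic polynomial with simple zeros at the nodes `μ(s), …, μ(t - 1)`. -/
noncomputable def qRacahNodal (s t : ℕ) : ℝ[X] :=
  Lagrange.nodal (Finset.Ico s t) (qRacahNode q γ δ)

theorem monic_qRacahNodal (s t : ℕ) : (qRacahNodal q γ δ s t).Monic :=
  Lagrange.nodal_monic

theorem natDegree_qRacahNodal (s t : ℕ) : (qRacahNodal q γ δ s t).natDegree = t - s := by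
  rw [qRacahNodal, Lagrange.natDegree_nodal, Nat.card_Ico]

theorem qRacahNodal_succ {s t : ℕ} (hst : s ≤ t) :
    qRacahNodal q γ δ s (t + 1)
      = qRacahNodal q γ δ s t * (X - C (qRacahNode q γ δ t)) :=
  Finset.prod_Ico_succ_top hst _

variable {γ δ}

theorem eval_qRacahNodal_eq_zero {s t x : ℕ} (hx : x ∈ Finset.Ico s t) :
    (qRacahNodal q γ δ s t).eval (qRacahNode q γ δ x) = 0 :=
  Lagrange.eval_nodal_at_node hx

theorem eval_qRacahNodal_ne_zero {s t x N : ℕ}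
    (hinj : Set.InjOn (qRacahNode q γ δ) (Set.Iic N)) (hx : x ≤ N) (ht : t ≤ N + 1)
    (hxt : x ∉ Finset.Ico s t) :
    (qRacahNodal q γ δ s t).eval (qRacahNode q γ δ x) ≠ 0 := by
  refine Lagrange.eval_nodal_not_at_node fun y hy hxy => hxt ?_
  have hyN : y ≤ N := by rw [Finset.mem_Ico] at hy; lia
  rwa [hinj hx hyN hxy]

/-- Moving from `μ(x)` to `μ(x + 1)` changes only the extreme factors of a product over
consecutive nodes. -/
theorem eval_qRacahNodal_node_succ (hq : q ≠ 0) {s t : ℕ} (hst : s ≤ t) (x : ℕ) :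
    (q ^ t - q ^ (x + 1)) * (1 - γ * δ * q ^ (x + 1 + s))
        * (qRacahNodal q γ δ s t).eval (qRacahNode q γ δ (x + 1))
      = (q ^ s - q ^ (x + 1)) * (1 - γ * δ * q ^ (x + 1 + t))
        * (qRacahNodal q γ δ s t).eval (qRacahNode q γ δ x) := by
  induction t, hst using Nat.le_induction with
  | base => simp [qRacahNodal]
  | succ t hst ih =>
    have hfactor : (q ^ (t + 1) - q ^ (x + 1)) * ((q ^ (x + 1))⁻¹ - (q ^ t)⁻¹)
        = (q ^ t - q ^ (x + 1)) * ((q ^ x)⁻¹ - (q ^ t)⁻¹) := by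
      field_simp
      ring
    simp only [qRacahNodal_succ γ δ hst, eval_mul, eval_sub, eval_X, eval_C,
      qRacahNode_sub γ δ hq]
    rw [show x + 1 + t + 1 = x + 1 + (t + 1) by ring, show x + t + 1 = x + 1 + t by ring]
    linear_combination (1 - γ * δ * q ^ (x + 1 + (t + 1)))
      * (((q ^ x)⁻¹ - (q ^ t)⁻¹) * ih + (1 - γ * δ * q ^ (x + 1 + s))
        * (qRacahNodal q γ δ s t).eval (qRacahNode q γ δ (x + 1)) * hfactor)

variable (γ δ)

theorem qRacahBasis_eq_nodal (hq : q ≠ 0) (m : ℕ) :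
    qRacahBasis q γ δ m
      = C (∏ j ∈ Finset.range m, -q ^ j) * qRacahNodal q γ δ 0 m := by
  rw [qRacahBasis, qRacahNodal, ← Finset.range_eq_Ico, Lagrange.nodal_eq, map_prod,
    ← Finset.prod_mul_distrib]
  refine Finset.prod_congr rfl fun j _ => ?_
  have hnode : 1 + γ * δ * q ^ (2 * j + 1) = q ^ j * qRacahNode q γ δ j := by
    rw [qRacahNode]
    field_simp
    ring
  rw [hnode, C_mul, C_neg]
  ring

theorem qRacahBasis_succ (m : ℕ) :
    qRacahBasis q γ δ (m + 1)
      = qRacahBasis q γ δ m * (C (1 + γ * δ * q ^ (2 * m + 1)) - C (q ^ m) * X) :=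
  Finset.prod_range_succ _ m

theorem prod_neg_pow_ne_zero (hq : q ≠ 0) (m : ℕ) : ∏ j ∈ Finset.range m, -q ^ j ≠ 0 :=
  Finset.prod_ne_zero_iff.2 fun j _ => neg_ne_zero.2 (pow_ne_zero j hq)

theorem degree_qRacahBasis (hq : q ≠ 0) (m : ℕ) : (qRacahBasis q γ δ m).degree = m := by
  rw [qRacahBasis_eq_nodal γ δ hq, degree_C_mul (prod_neg_pow_ne_zero hq m),
    degree_eq_natDegree (monic_qRacahNodal γ δ 0 m).ne_zero, natDegree_qRacahNodal, Nat.sub_zero]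

theorem natDegree_qRacahPoly (hq : q ≠ 0) {n : ℕ} {α β γ δ : ℝ} (hα : qPoch (α * q) q n ≠ 0)
    (hβδ : qPoch (β * δ * q) q n ≠ 0) (hγ : qPoch (γ * q) q n ≠ 0)
    (hαβ : qPoch (α * β * q ^ (n + 1)) q n ≠ 0) (hqn : qPoch q q n ≠ 0) :
    (qRacahPoly q n α β γ δ).natDegree = n := by
  have hqn' := qPoch_inv_pow_ne_zero hq hqn
  rw [qRacahPoly, natDegree_C_mul (by positivity), Finset.sum_range_succ,
    natDegree_add_eq_right_of_degree_lt, natDegree_C_mul (by positivity),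
    natDegree_eq_of_degree_eq_some (degree_qRacahBasis γ δ hq n)]
  rw [degree_C_mul (by positivity), degree_qRacahBasis γ δ hq]
  refine mem_degreeLT.1 (Submodule.sum_mem _ fun m hm => mem_degreeLT.2 ?_)
  refine degree_mul_le_of_le (degree_C_le) (degree_qRacahBasis γ δ hq m).le |>.trans_lt ?_
  rw [zero_add]
  exact_mod_cast Finset.mem_range.1 hm

end Nodes

section Recurrence

variable {q α β γ δ : ℝ} {N : ℕ}

theorem one_sub_ne_zero_of_qRacahWeight_ne_zero {x : ℕ} (hw : qRacahWeight q α β γ δ x ≠ 0) :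
    1 - γ * δ * q ^ (2 * x + 1) ≠ 0 :=
  right_ne_zero_of_mul (div_ne_zero_iff.1 hw).1

/-- The Pearson equation of the `q`-Racah weight. -/
theorem qRacahWeight_succ {x : ℕ} (hw : qRacahWeight q α β γ δ x ≠ 0)
    (hw' : qRacahWeight q α β γ δ (x + 1) ≠ 0) :
    qRacahWeight q α β γ δ (x + 1) * ((1 - q ^ (x + 1)) * (α - γ * δ * q ^ (x + 1))
        * (β - γ * q ^ (x + 1)) * (1 - δ * q ^ (x + 1)) * q * (1 - γ * δ * q ^ (2 * x + 1)))
      = qRacahWeight q α β γ δ x * ((1 - α * q ^ (x + 1)) * (1 - β * δ * q ^ (x + 1))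
        * (1 - γ * q ^ (x + 1)) * (1 - γ * δ * q ^ (x + 1))
        * (1 - γ * δ * q ^ (2 * (x + 1) + 1))) := by
  unfold qRacahWeight at *
  have hden := (div_ne_zero_iff.1 hw).2
  have hden' := (div_ne_zero_iff.1 hw').2
  have hαβ : α * β * q ≠ 0 := by
    simp only [mul_ne_zero_iff, pow_ne_zero_iff x.succ_ne_zero] at hden'
    simp only [mul_ne_zero_iff]
    tauto
  have hα : α ≠ 0 := left_ne_zero_of_mul (left_ne_zero_of_mul hαβ)
  have hβ : β ≠ 0 := right_ne_zero_of_mul (left_ne_zero_of_mul hαβ)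
  have hαγδ : α - γ * δ * q ^ (x + 1) = α * (1 - γ * δ * q / α * q ^ x) := by field_simp; ring
  have hβγ : β - γ * q ^ (x + 1) = β * (1 - γ * q / β * q ^ x) := by field_simp; ring
  rw [hαγδ, hβγ]
  generalize γ * δ * q / α = u at *
  generalize γ * q / β = v at *
  rw [div_mul_eq_mul_div, div_mul_eq_mul_div, div_eq_div_iff hden' hden]
  simp only [qPoch_succ, pow_succ]
  ring

theorem eval_qRacahNodal_top_node_succ (hq : q ≠ 0) (hα : α * q ^ (N + 1) = 1) {s : ℕ}
    (hs : s ≤ N) (x : ℕ) :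
    (1 - α * q ^ (x + 1)) * (1 - γ * δ * q ^ (x + 1 + (s + 1)))
        * (qRacahNodal q γ δ (s + 1) (N + 1)).eval (qRacahNode q γ δ (x + 1))
      = (q ^ (s + 1) - q ^ (x + 1)) * (α - γ * δ * q ^ (x + 1))
        * (qRacahNodal q γ δ (s + 1) (N + 1)).eval (qRacahNode q γ δ x) := by
  have hshift := eval_qRacahNodal_node_succ (γ := γ) (δ := δ) hq (show s + 1 ≤ N + 1 by lia) x
  rw [pow_add q (x + 1) (N + 1)] at hshift
  linear_combination α * hshift
    - ((1 - γ * δ * q ^ (x + 1 + (s + 1)))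
        * (qRacahNodal q γ δ (s + 1) (N + 1)).eval (qRacahNode q γ δ (x + 1))
      + (q ^ (s + 1) - q ^ (x + 1)) * (γ * δ * q ^ (x + 1))
        * (qRacahNodal q γ δ (s + 1) (N + 1)).eval (qRacahNode q γ δ x)) * hα

/-- The coefficient with which the summand at `x` leaves towards `x + 1` in the telescoping sum for
`qRacahBasis q γ δ m * qRacahNodal q γ δ (s + 1) (N + 1)`. -/
noncomputable def forwardFlux (q β γ δ : ℝ) (m s x : ℕ) : ℝ :=
  (1 - γ * δ * q ^ (x + 1 + m)) * (q ^ s - q ^ x) * (1 - β * δ * q ^ (x + 1))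
    * (1 - γ * q ^ (x + 1)) / (q ^ x * (1 - γ * δ * q ^ (2 * x + 1)))

/-- The counterpart of `forwardFlux`, with which the summand at `x` leaves towards `x - 1`. -/
noncomputable def backwardFlux (q β γ δ : ℝ) (m s x : ℕ) : ℝ :=
  q * (q ^ m - q ^ x) * (1 - γ * δ * q ^ (x + 1 + s)) * (β - γ * q ^ x) * (1 - δ * q ^ x)
    / (q ^ x * (1 - γ * δ * q ^ (2 * x + 1)))

theorem backwardFlux_succ_mul (hq : q ≠ 0) (hα : α * q ^ (N + 1) = 1) (m : ℕ) {s x : ℕ}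
    (hs : s ≤ N) (hw : qRacahWeight q α β γ δ x ≠ 0)
    (hw' : qRacahWeight q α β γ δ (x + 1) ≠ 0) :
    backwardFlux q β γ δ m s (x + 1)
        * ((qRacahBasis q γ δ m * qRacahNodal q γ δ (s + 1) (N + 1)).eval
          (qRacahNode q γ δ (x + 1)) * qRacahWeight q α β γ δ (x + 1))
      = forwardFlux q β γ δ m s x
        * ((qRacahBasis q γ δ m * qRacahNodal q γ δ (s + 1) (N + 1)).eval
          (qRacahNode q γ δ x) * qRacahWeight q α β γ δ x) := by
  have hcancel : (1 - α * q ^ (x + 1)) * (1 - γ * δ * q ^ (x + 1)) ≠ 0 := by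
    have hnum := (div_ne_zero_iff.1 hw').1
    simp only [qPoch_succ, mul_ne_zero_iff, mul_assoc, ← pow_succ'] at hnum
    simp only [mul_ne_zero_iff, mul_assoc]
    tauto
  have hone := one_sub_ne_zero_of_qRacahWeight_ne_zero hw
  have hone' := one_sub_ne_zero_of_qRacahWeight_ne_zero hw'
  have pearson := qRacahWeight_succ hw hw'
  have hbasis := eval_qRacahNodal_node_succ (γ := γ) (δ := δ) hq m.zero_le x
  have hnodal := eval_qRacahNodal_top_node_succ (γ := γ) (δ := δ) hq hα hs x
  rw [qRacahBasis_eq_nodal γ δ hq]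
  simp only [eval_mul, eval_C, backwardFlux, forwardFlux]
  generalize qRacahWeight q α β γ δ (x + 1) = w' at *
  generalize qRacahWeight q α β γ δ x = w at *
  generalize (qRacahNodal q γ δ 0 m).eval (qRacahNode q γ δ (x + 1)) = φ' at *
  generalize (qRacahNodal q γ δ 0 m).eval (qRacahNode q γ δ x) = φ at *
  generalize (qRacahNodal q γ δ (s + 1) (N + 1)).eval (qRacahNode q γ δ (x + 1)) = ψ' at *
  generalize (qRacahNodal q γ δ (s + 1) (N + 1)).eval (qRacahNode q γ δ x) = ψ at *
  rw [div_mul_eq_mul_div, div_mul_eq_mul_div,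
    div_eq_div_iff (mul_ne_zero (pow_ne_zero _ hq) hone') (mul_ne_zero (pow_ne_zero _ hq) hone)]
  refine mul_left_cancel₀ hcancel ?_
  generalize ∏ j ∈ Finset.range m, -q ^ j = c
  linear_combination c * q ^ x * (1 - γ * δ * q ^ (2 * x + 1)) * q * (β - γ * q ^ (x + 1))
      * (1 - δ * q ^ (x + 1)) * w'
      * ((1 - α * q ^ (x + 1)) * (1 - γ * δ * q ^ (x + 1 + (s + 1))) * ψ' * hbasis
        + (1 - q ^ (x + 1)) * (1 - γ * δ * q ^ (x + 1 + m)) * φ * hnodal)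
    + c * q ^ x * φ * ψ * (1 - γ * δ * q ^ (x + 1 + m)) * q * (q ^ s - q ^ x) * pearson

theorem backwardFlux_zero_mul (hq : q ≠ 0) (m s : ℕ) :
    backwardFlux q β γ δ m s 0 * (qRacahBasis q γ δ m).eval (qRacahNode q γ δ 0) = 0 := by
  rcases m.eq_zero_or_pos with rfl | hm
  · simp [backwardFlux]
  · rw [qRacahBasis_eq_nodal γ δ hq, eval_mul,
      eval_qRacahNodal_eq_zero (Finset.mem_Ico.2 ⟨le_rfl, hm⟩), mul_zero, mul_zero]

theorem forwardFlux_top_mul (m : ℕ) {s : ℕ} (hs : s ≤ N) :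
    forwardFlux q β γ δ m s N
      * (qRacahNodal q γ δ (s + 1) (N + 1)).eval (qRacahNode q γ δ N) = 0 := by
  rcases hs.eq_or_lt with rfl | hs
  · simp [forwardFlux]
  · rw [eval_qRacahNodal_eq_zero (Finset.mem_Ico.2 ⟨hs, N.lt_succ_self⟩), mul_zero]

theorem sum_forwardFlux_sub_backwardFlux (hq : q ≠ 0) (hα : α * q ^ (N + 1) = 1)
    (hw : ∀ x ≤ N, qRacahWeight q α β γ δ x ≠ 0) (m : ℕ) {s : ℕ} (hs : s ≤ N) :
    ∑ x ∈ Finset.range (N + 1), (forwardFlux q β γ δ m s x - backwardFlux q β γ δ m s x)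
      * ((qRacahBasis q γ δ m * qRacahNodal q γ δ (s + 1) (N + 1)).eval (qRacahNode q γ δ x)
        * qRacahWeight q α β γ δ x) = 0 := by
  simp only [sub_mul, Finset.sum_sub_distrib]
  rw [Finset.sum_range_succ, Finset.sum_range_succ' (fun x => backwardFlux q β γ δ m s x * _),
    Finset.sum_congr rfl fun x hx => backwardFlux_succ_mul hq hα m hs
      (hw x (Finset.mem_range.1 hx).le) (hw (x + 1) (Finset.mem_range.1 hx))]
  rw [eval_mul, eval_mul]
  linear_combination
    (qRacahBasis q γ δ m).eval (qRacahNode q γ δ N) * qRacahWeight q α β γ δ N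
        * forwardFlux_top_mul (β := β) m hs
      - (qRacahNodal q γ δ (s + 1) (N + 1)).eval (qRacahNode q γ δ 0)
        * qRacahWeight q α β γ δ 0 * backwardFlux_zero_mul (β := β) hq m s

theorem pow_mul_forwardFlux_sub_backwardFlux (hq : q ≠ 0) (m s : ℕ) {x : ℕ}
    (hx : 1 - γ * δ * q ^ (2 * x + 1) ≠ 0) :
    q ^ m * (forwardFlux q β γ δ m s x - backwardFlux q β γ δ m s x)
      = (1 - β * δ * q ^ (m + 1)) * (1 - γ * q ^ (m + 1)) * (q ^ s - q ^ m)
        - (q ^ s - β * q ^ (m + 1))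
          * (1 + γ * δ * q ^ (2 * m + 1) - q ^ m * qRacahNode q γ δ x) := by
  rw [forwardFlux, backwardFlux, qRacahNode]
  field_simp
  ring

theorem momentFunctional_qRacahBasis_succ_mul (hq : q ≠ 0) (hα : α * q ^ (N + 1) = 1)
    (hw : ∀ x ≤ N, qRacahWeight q α β γ δ x ≠ 0) (m : ℕ) {s : ℕ} (hs : s ≤ N) :
    (q ^ s - β * q ^ (m + 1)) * momentFunctional N (qRacahNode q γ δ) (qRacahWeight q α β γ δ)
        (qRacahBasis q γ δ (m + 1) * qRacahNodal q γ δ (s + 1) (N + 1))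
      = (1 - β * δ * q ^ (m + 1)) * (1 - γ * q ^ (m + 1)) * (q ^ s - q ^ m)
        * momentFunctional N (qRacahNode q γ δ) (qRacahWeight q α β γ δ)
          (qRacahBasis q γ δ m * qRacahNodal q γ δ (s + 1) (N + 1)) := by
  have htele := congrArg (q ^ m * ·) (sum_forwardFlux_sub_backwardFlux hq hα hw m hs)
  simp only [mul_zero, Finset.mul_sum] at htele
  rw [momentFunctional_apply, momentFunctional_apply, ← sub_eq_zero, Finset.mul_sum,
    Finset.mul_sum, ← Finset.sum_sub_distrib, ← neg_eq_zero, ← Finset.sum_neg_distrib, ← htele]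
  refine Finset.sum_congr rfl fun x hx => ?_
  have hone := one_sub_ne_zero_of_qRacahWeight_ne_zero
    (hw x (Nat.lt_succ_iff.1 (Finset.mem_range.1 hx)))
  rw [← mul_assoc (q ^ m), pow_mul_forwardFlux_sub_backwardFlux hq m s hone, qRacahBasis_succ]
  simp only [eval_mul, eval_sub, eval_C, eval_X]
  ring

theorem momentFunctional_qRacahBasis_mul (hq : q ≠ 0) (hα : α * q ^ (N + 1) = 1)
    (hw : ∀ x ≤ N, qRacahWeight q α β γ δ x ≠ 0) (m : ℕ) {s : ℕ} (hs : s ≤ N) :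
    qPoch (β * q / q ^ s) q m
        * momentFunctional N (qRacahNode q γ δ) (qRacahWeight q α β γ δ)
          (qRacahBasis q γ δ m * qRacahNodal q γ δ (s + 1) (N + 1))
      = qPoch (β * δ * q) q m * qPoch (γ * q) q m * qPoch (q ^ s)⁻¹ q m
        * momentFunctional N (qRacahNode q γ δ) (qRacahWeight q α β γ δ)
          (qRacahNodal q γ δ (s + 1) (N + 1)) := by
  induction m with
  | zero => simp [qPoch_zero, qRacahBasis]
  | succ m ih =>
    have hβ : q ^ s - β * q ^ (m + 1) = q ^ s * (1 - β * q / q ^ s * q ^ m) := by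
      field_simp
      ring
    have hone : q ^ s - q ^ m = q ^ s * (1 - (q ^ s)⁻¹ * q ^ m) := by field_simp
    have hrec := momentFunctional_qRacahBasis_succ_mul hq hα hw m hs
    rw [hβ, hone, pow_succ'] at hrec
    refine mul_left_cancel₀ (pow_ne_zero s hq) ?_
    simp only [qPoch_succ]
    linear_combination qPoch (β * q / q ^ s) q m * hrec
      + (1 - β * δ * q * q ^ m) * (1 - γ * q * q ^ m) * (1 - (q ^ s)⁻¹ * q ^ m) * q ^ s * ih

theorem momentFunctional_qRacahNodal_ne_zero (hq : q ≠ 0) (hα : α * q ^ (N + 1) = 1)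
    (hinj : Set.InjOn (qRacahNode q γ δ) (Set.Iic N))
    (hw : ∀ x ≤ N, qRacahWeight q α β γ δ x ≠ 0) {s : ℕ} (hs : s ≤ N)
    (hβ : qPoch (β * q / q ^ s) q s ≠ 0) :
    momentFunctional N (qRacahNode q γ δ) (qRacahWeight q α β γ δ)
      (qRacahNodal q γ δ (s + 1) (N + 1)) ≠ 0 := by
  have hbasis {x : ℕ} : (qRacahBasis q γ δ s).eval (qRacahNode q γ δ x)
      = (∏ j ∈ Finset.range s, -q ^ j)
        * (qRacahNodal q γ δ 0 s).eval (qRacahNode q γ δ x) := by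
    rw [qRacahBasis_eq_nodal γ δ hq, eval_mul, eval_C]
  -- The product vanishes at every node except `μ(s)`.
  have hsingle : momentFunctional N (qRacahNode q γ δ) (qRacahWeight q α β γ δ)
      (qRacahBasis q γ δ s * qRacahNodal q γ δ (s + 1) (N + 1)) ≠ 0 := by
    rw [momentFunctional_apply, Finset.sum_eq_single_of_mem s (Finset.mem_range_succ_iff.2 hs),
      eval_mul, hbasis]
    · exact mul_ne_zero (mul_ne_zero (mul_ne_zero (prod_neg_pow_ne_zero hq s)
        (eval_qRacahNodal_ne_zero hinj hs (by lia) (by simp)))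
        (eval_qRacahNodal_ne_zero hinj hs le_rfl (by simp))) (hw s hs)
    · intro x hx hxs
      rw [Finset.mem_range] at hx
      rw [eval_mul, hbasis]
      rcases hxs.lt_or_gt with hlt | hlt
      · rw [eval_qRacahNodal_eq_zero (Finset.mem_Ico.2 ⟨x.zero_le, hlt⟩)]
        simp only [mul_zero, zero_mul]
      · rw [eval_qRacahNodal_eq_zero (Finset.mem_Ico.2 ⟨hlt, hx⟩), mul_zero, zero_mul]
  intro hzero
  refine mul_ne_zero hβ hsingle ?_
  rw [momentFunctional_qRacahBasis_mul hq hα hw s hs, hzero, mul_zero]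

theorem coeff_mul_momentFunctional_qRacahBasis_mul (hq : q ≠ 0) (hα : α * q ^ (N + 1) = 1)
    (hw : ∀ x ≤ N, qRacahWeight q α β γ δ x ≠ 0) (a : ℝ) (n : ℕ) {m s : ℕ} (hs : s ≤ N)
    (hβδ : qPoch (β * δ * q) q m ≠ 0) (hγ : qPoch (γ * q) q m ≠ 0)
    (hβ : qPoch (β * q / q ^ s) q m ≠ 0) :
    qPoch (q ^ n)⁻¹ q m * qPoch (a * β * q ^ (n + 1)) q m
          / (qPoch (a * q) q m * qPoch (β * δ * q) q m * qPoch (γ * q) q m * qPoch q q m) * q ^ m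
        * momentFunctional N (qRacahNode q γ δ) (qRacahWeight q α β γ δ)
          (qRacahBasis q γ δ m * qRacahNodal q γ δ (s + 1) (N + 1))
      = saalschutzTerm q (q ^ s)⁻¹ (a * q) (β * q / q ^ s) (a * β * q) n m
        * momentFunctional N (qRacahNode q γ δ) (qRacahWeight q α β γ δ)
          (qRacahNodal q γ δ (s + 1) (N + 1)) := by
  rw [eq_div_of_mul_eq hβ ((mul_comm _ _).trans (momentFunctional_qRacahBasis_mul hq hα hw m hs)),
    saalschutzTerm, pow_succ', ← mul_assoc (a * β) q]
  generalize qPoch (β * δ * q) q m = u at *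
  generalize qPoch (γ * q) q m = v at *
  generalize qPoch (β * q / q ^ s) q m = t at *
  simp only [div_eq_mul_inv, mul_inv]
  field_simp

/-- The functional turns each basis polynomial into a quotient of `q`-Pochhammer symbols, so the
`₄φ₃` series of the polynomial becomes a balanced `₃φ₂`, which Saalschütz's formula sums. -/
theorem momentFunctional_qRacahNodal_mul_qRacahPoly (hq : q ≠ 0) (hα : α * q ^ (N + 1) = 1)
    (hw : ∀ x ≤ N, qRacahWeight q α β γ δ x ≠ 0) {a : ℝ} {n s : ℕ} (hs : s ≤ N)
    (ha : qPoch (a * q) q n ≠ 0) (hβδ : qPoch (β * δ * q) q n ≠ 0)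
    (hγ : qPoch (γ * q) q n ≠ 0) (hβ : qPoch (β * q / q ^ s) q n ≠ 0)
    (hqn : qPoch q q n ≠ 0) :
    momentFunctional N (qRacahNode q γ δ) (qRacahWeight q α β γ δ)
        (qRacahNodal q γ δ (s + 1) (N + 1) * qRacahPoly q n a β γ δ)
      = qPoch (β * δ * q) q n * qPoch (γ * q) q n * qPoch (β * q) q n
          * qPoch (a * q ^ (s + 1)) q n * (q ^ s)⁻¹ ^ n
          / (qPoch (a * β * q ^ (n + 1)) q n * qPoch (β * q / q ^ s) q n)
        * momentFunctional N (qRacahNode q γ δ) (qRacahWeight q α β γ δ)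
          (qRacahNodal q γ δ (s + 1) (N + 1)) := by
  have hsaal := sum_saalschutzTerm (a := (q ^ s)⁻¹) (c := a * q) (d := β * q / q ^ s)
    (e := a * β * q) hq (by positivity) (by field_simp) ha hβ hqn
  rw [div_inv_eq_mul, div_inv_eq_mul, div_mul_cancel₀ _ (pow_ne_zero s hq), mul_assoc a q,
    ← pow_succ'] at hsaal
  simp only [qRacahPoly, ← smul_eq_C_mul, mul_comm (qRacahNodal q γ δ _ _), smul_mul_assoc,
    Finset.sum_mul, map_smul, map_sum, smul_eq_mul]
  rw [Finset.sum_congr rfl fun m hm =>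
      have hmn : m ≤ n := Finset.mem_range_succ_iff.1 hm
      coeff_mul_momentFunctional_qRacahBasis_mul hq hα hw a n hs (qPoch_ne_zero_of_le hmn hβδ)
        (qPoch_ne_zero_of_le hmn hγ) (qPoch_ne_zero_of_le hmn hβ),
    ← Finset.sum_mul, hsaal]
  generalize qPoch (a * q) q n = u at *
  generalize qPoch (β * q / q ^ s) q n = v at *
  simp only [div_eq_mul_inv, mul_inv]
  field_simp

end Recurrence

section ShiftedParameter

variable {q α β γ δ : ℝ} {N n k : ℕ}

theorem shifted_param_mul_pow (hq : q ≠ 0) (hα : α * q ^ (N + 1) = 1) {l : ℕ} (hl : l ≤ N) :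
    α / q ^ k * q ^ (N - l + 1) * q ^ (k + l) = 1 := by
  rw [← hα, show N + 1 = N - l + 1 + l by lia, pow_add q (N - l + 1), pow_add q k]
  field_simp

namespace QRacahAdmissible

theorem qPoch_ne_zero (h : QRacahAdmissible q N α β γ δ) {m : ℕ} (hm : m ≤ N) :
    qPoch (β * δ * q) q m ≠ 0 ∧ qPoch (γ * q) q m ≠ 0 ∧ qPoch q q m ≠ 0 := by
  have hw := div_ne_zero_iff.1 (h.weight_ne_zero m hm)
  simp only [mul_ne_zero_iff] at hw
  tauto

theorem pow_ne_one (h : QRacahAdmissible q N α β γ δ) {i : ℕ} (hi : 0 < i) (hiN : i < 2 * N) :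
    q ^ i ≠ 1 := by
  have hpow : ∀ j < N, q ^ (j + 1) ≠ 1 := by
    simpa only [pow_succ'] using qPoch_ne_zero_iff.1 (h.qPoch_ne_zero le_rfl).2.2
  intro hone
  rcases pow_eq_one_iff_cases.1 hone with rfl | rfl | ⟨rfl, heven⟩
  · exact hi.false
  · exact hpow 0 (by lia) (one_pow 1)
  · exact hpow 1 (by rcases heven with ⟨r, rfl⟩; lia) neg_one_sq

theorem qPoch_shift_ne_zero (h : QRacahAdmissible q N α β γ δ) (hq : q ≠ 0)
    (hα : α * q ^ (N + 1) = 1) (hkn : k < n) (hnN : n ≤ N) : qPoch (α / q ^ k * q) q n ≠ 0 := by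
  refine qPoch_ne_zero_iff.2 fun j hj hone =>
    h.pow_ne_one (i := N + k - j) (by lia) (by lia) ?_
  have hsplit : q ^ (N + k - j) * q ^ (j + 1) = q ^ (N + 1) * q ^ k := by
    rw [← pow_add, ← pow_add]
    congr 1
    lia
  field_simp at hone
  refine mul_right_cancel₀ (pow_ne_zero (j + 1) hq) ?_
  rw [hsplit, ← hone, pow_succ']
  linear_combination q * q ^ j * hα

theorem qPoch_shift_mul_ne_zero (h : QRacahAdmissible q N α β γ δ) (hq : q ≠ 0) (hkn : k < n)
    (hnN : n ≤ N) : qPoch (α / q ^ k * β * q ^ (n + 1)) q n ≠ 0 := by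
  refine qPoch_ne_zero_iff.2 fun j hj hone =>
    h.param_ne (n - k + 1 + j) (by lia) (by lia) ?_
  rw [← hone, show n + 1 = k + (n - k + 1) by lia, pow_add q k]
  field_simp
  ring

theorem qPoch_div_pow_ne_zero (h : QRacahAdmissible q N α β γ δ) (hq : q ≠ 0)
    (hα : α * q ^ (N + 1) = 1) {m s : ℕ} (hs₀ : 0 < s) (hs : s ≤ N) (hm : m ≤ N) :
    qPoch (β * q / q ^ s) q m ≠ 0 := by
  refine qPoch_ne_zero_iff.2 fun j hj hone =>
    h.param_ne (N + 2 + j - s) (by lia) (by lia) ?_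
  have hsplit : q ^ (N + 2 + j - s) * q ^ s = q ^ (N + 1) * (q * q ^ j) := by
    rw [← pow_add, ← pow_succ', ← pow_add]
    congr 1
    lia
  refine mul_right_cancel₀ (pow_ne_zero s hq) ?_
  field_simp at hone
  linear_combination α * β * hsplit + β * q * q ^ j * hα + hone

theorem qPoch_mul_ne_zero (h : QRacahAdmissible q N α β γ δ) (hα : α * q ^ (N + 1) = 1)
    (hnN : n ≤ N) (hβ : β * q ^ n ≠ 1) : qPoch (β * q) q n ≠ 0 := by
  refine qPoch_ne_zero_iff.2 fun j hj hone => ?_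
  rw [mul_assoc, ← pow_succ'] at hone
  rcases (Nat.succ_le_of_lt hj).eq_or_lt with rfl | hjn
  · exact hβ hone
  · refine h.param_ne (N + 1 + (j + 1)) (by lia) (by lia) ?_
    rw [pow_add]
    linear_combination β * q ^ (j + 1) * hα + hone

theorem momentFunctional_nodal_ne_zero (h : QRacahAdmissible q N α β γ δ) (hq : q ≠ 0)
    (hα : α * q ^ (N + 1) = 1) {s : ℕ} (hs : s ≤ N) :
    momentFunctional N (qRacahNode q γ δ) (qRacahWeight q α β γ δ)
      (qRacahNodal q γ δ (s + 1) (N + 1)) ≠ 0 := by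
  refine momentFunctional_qRacahNodal_ne_zero hq hα h.node_injOn h.weight_ne_zero hs ?_
  rcases s.eq_zero_or_pos with rfl | hpos
  · exact (qPoch_zero _ _).trans_ne one_ne_zero
  · exact h.qPoch_div_pow_ne_zero hq hα hpos hs hs

theorem momentFunctional_nodal_mul_shift (h : QRacahAdmissible q N α β γ δ) (hq : q ≠ 0)
    (hα : α * q ^ (N + 1) = 1) (hkn : k < n) (hnN : n ≤ N) {s : ℕ} (hs : s ≤ N)
    (hβ : qPoch (β * q / q ^ s) q n ≠ 0) :
    momentFunctional N (qRacahNode q γ δ) (qRacahWeight q α β γ δ)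
        (qRacahNodal q γ δ (s + 1) (N + 1) * qRacahPoly q n (α / q ^ k) β γ δ)
      = qPoch (β * δ * q) q n * qPoch (γ * q) q n * qPoch (β * q) q n
          * qPoch (α / q ^ k * q ^ (s + 1)) q n * (q ^ s)⁻¹ ^ n
          / (qPoch (α / q ^ k * β * q ^ (n + 1)) q n * qPoch (β * q / q ^ s) q n)
        * momentFunctional N (qRacahNode q γ δ) (qRacahWeight q α β γ δ)
          (qRacahNodal q γ δ (s + 1) (N + 1)) :=
  momentFunctional_qRacahNodal_mul_qRacahPoly hq hα h.weight_ne_zero hs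
    (h.qPoch_shift_ne_zero hq hα hkn hnN) (h.qPoch_ne_zero hnN).1 (h.qPoch_ne_zero hnN).2.1 hβ
    (h.qPoch_ne_zero hnN).2.2

theorem momentFunctional_mul_shift_eq_zero (h : QRacahAdmissible q N α β γ δ) (hq : q ≠ 0)
    (hα : α * q ^ (N + 1) = 1) (hkn : k < n) (hnN : n ≤ N) {P : ℝ[X]}
    (hP : P.degree < (n - k : ℕ)) :
    momentFunctional N (qRacahNode q γ δ) (qRacahWeight q α β γ δ)
      (P * qRacahPoly q n (α / q ^ k) β γ δ) = 0 := by
  refine map_eq_zero_of_monic_of_degree_lt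
    (momentFunctional N (qRacahNode q γ δ) (qRacahWeight q α β γ δ)
      ∘ₗ LinearMap.mulRight ℝ (qRacahPoly q n (α / q ^ k) β γ δ))
    (p := fun l => qRacahNodal q γ δ (N - l + 1) (N + 1))
    (fun l _ => monic_qRacahNodal _ _ _ _)
    (fun l hl => (natDegree_qRacahNodal _ _ _ _).trans (by lia)) (fun l hl => ?_) hP
  have hfactor : qPoch (α / q ^ k * q ^ (N - l + 1)) q n = 0 :=
    qPoch_eq_zero (show k + l < n by lia) (shifted_param_mul_pow hq hα (by lia))
  rw [LinearMap.comp_apply, LinearMap.mulRight_apply,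
    h.momentFunctional_nodal_mul_shift hq hα hkn hnN (N.sub_le l)
      (h.qPoch_div_pow_ne_zero hq hα (by lia) (N.sub_le l) hnN),
    hfactor, mul_zero, zero_mul, zero_div, zero_mul]

theorem momentFunctional_nodal_mul_shift_ne_zero (h : QRacahAdmissible q N α β γ δ) (hq : q ≠ 0)
    (hα : α * q ^ (N + 1) = 1) (hkn : k < n) (hnN : n ≤ N) (hβ : β * q ^ n ≠ 1) :
    momentFunctional N (qRacahNode q γ δ) (qRacahWeight q α β γ δ)
      (qRacahNodal q γ δ (N - (n - k) + 1) (N + 1) * qRacahPoly q n (α / q ^ k) β γ δ) ≠ 0 := by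
  have hfactor : qPoch (α / q ^ k * q ^ (N - (n - k) + 1)) q n ≠ 0 := by
    refine qPoch_ne_zero_iff.2 fun j hj hone =>
      h.pow_ne_one (i := n - j) (by lia) (by lia) ?_
    have hend := shifted_param_mul_pow (k := k) hq hα (show n - k ≤ N by lia)
    rw [show k + (n - k) = j + (n - j) by lia, pow_add q j, ← mul_assoc, hone, one_mul] at hend
    exact hend
  have hβq := h.qPoch_mul_ne_zero hα hnN hβ
  have hβs : qPoch (β * q / q ^ (N - (n - k))) q n ≠ 0 := by
    rcases (N - (n - k)).eq_zero_or_pos with h0 | hpos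
    · rwa [h0, pow_zero, div_one]
    · exact h.qPoch_div_pow_ne_zero hq hα hpos (N.sub_le _) hnN
  obtain ⟨hβδ, hγ, -⟩ := h.qPoch_ne_zero hnN
  have hαβ := h.qPoch_shift_mul_ne_zero hq hkn hnN
  have hnodal := h.momentFunctional_nodal_ne_zero hq hα (N.sub_le (n - k))
  rw [h.momentFunctional_nodal_mul_shift hq hα hkn hnN (N.sub_le _) hβs]
  positivity

theorem isWeakQuasiOrthogonal_shift (h : QRacahAdmissible q N α β γ δ) (hq : q ≠ 0)
    (hα : α * q ^ (N + 1) = 1) (hkn : k < n) (hnN : n ≤ N) :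
    IsWeakQuasiOrthogonal N (qRacahNode q γ δ) (qRacahWeight q α β γ δ) n k
      (qRacahPoly q n (α / q ^ k) β γ δ) where
  natDegree_eq := natDegree_qRacahPoly hq (h.qPoch_shift_ne_zero hq hα hkn hnN)
    (h.qPoch_ne_zero hnN).1 (h.qPoch_ne_zero hnN).2.1 (h.qPoch_shift_mul_ne_zero hq hkn hnN)
    (h.qPoch_ne_zero hnN).2.2
  moment_eq_zero m hm := by
    rw [discreteMoment_eq_momentFunctional]
    refine h.momentFunctional_mul_shift_eq_zero hq hα hkn hnN ?_
    rw [degree_X_pow]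
    exact_mod_cast Nat.lt_sub_of_add_lt hm

theorem isDiscreteQuasiOrthogonal_shift (h : QRacahAdmissible q N α β γ δ) (hq : q ≠ 0)
    (hα : α * q ^ (N + 1) = 1) (hkn : k < n) (hnN : n ≤ N) (hβ : β * q ^ n ≠ 1) :
    IsDiscreteQuasiOrthogonal N (qRacahNode q γ δ) (qRacahWeight q α β γ δ) n k
      (qRacahPoly q n (α / q ^ k) β γ δ) where
  toIsWeakQuasiOrthogonal := h.isWeakQuasiOrthogonal_shift hq hα hkn hnN
  order_le := hkn.le
  moment_ne_zero := by
    have hdeg : (qRacahNodal q γ δ (N - (n - k) + 1) (N + 1)).natDegree = n - k :=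
      (natDegree_qRacahNodal _ _ _ _).trans (by lia)
    have hlead := map_X_pow_eq_map_monic
      (momentFunctional N (qRacahNode q γ δ) (qRacahWeight q α β γ δ)
        ∘ₗ LinearMap.mulRight ℝ (qRacahPoly q n (α / q ^ k) β γ δ))
      (monic_qRacahNodal γ δ (N - (n - k) + 1) (N + 1))
      fun P hP => h.momentFunctional_mul_shift_eq_zero hq hα hkn hnN (hdeg ▸ hP)
    simp only [hdeg, LinearMap.comp_apply, LinearMap.mulRight_apply] at hlead
    rw [discreteMoment_eq_momentFunctional, hlead]
    exact h.momentFunctional_nodal_mul_shift_ne_zero hq hα hkn hnN hβ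

theorem le_numZerosIoo_shift (h : QRacahAdmissible q N α β γ δ) (hq : q ≠ 0)
    (hα : α * q ^ (N + 1) = 1) (hkn : k < n) (hnN : n ≤ N) (hpos : QRacahPositive q N α β γ δ) :
    n - k ≤ numZerosIoo (qRacahPoly q n (α / q ^ k) β γ δ)
      (qRacahNode q γ δ 0) (qRacahNode q γ δ N) := by
  have hdeg := (h.isWeakQuasiOrthogonal_shift hq hα hkn hnN).natDegree_eq
  have hmono : StrictMonoOn (qRacahNode q γ δ) (Set.Iic N) :=
    strictMonoOn_of_lt_add_one Set.ordConnected_Iic fun x _ _ hx =>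
      hpos.node_lt x (by simpa using hx)
  refine le_numZerosIoo_of_orthogonal (by lia) (ne_zero_of_natDegree_gt (n := 0) (by lia))
    (hdeg.trans_le hnN) hmono hpos.weight_pos fun P hP => ?_
  exact h.momentFunctional_mul_shift_eq_zero hq hα hkn hnN hP

end QRacahAdmissible

end ShiftedParameter

section Symmetry

variable {q α β γ δ : ℝ} {N : ℕ}

theorem qRacahWeight_symm (q α β γ : ℝ) {δ : ℝ} (hδ : δ ≠ 0) :
    qRacahWeight q (β * δ) (α / δ) γ δ = qRacahWeight q α β γ δ := by
  have hγδ : γ * δ * q / (β * δ) = γ * q / β := by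
    rw [mul_right_comm, mul_div_mul_right _ _ hδ]
  have hγ : γ * q / (α / δ) = γ * δ * q / α := by rw [div_div_eq_mul_div, mul_right_comm]
  have hαβ : β * δ * (α / δ) = α * β := by field_simp
  funext x
  rw [qRacahWeight, qRacahWeight, div_mul_cancel₀ α hδ, hγδ, hγ, hαβ]
  ring

theorem qRacahPoly_symm (q : ℝ) (n : ℕ) (α β γ : ℝ) {δ : ℝ} (hδ : δ ≠ 0) :
    qRacahPoly q n (β * δ) (α / δ) γ δ = qRacahPoly q n α β γ δ := by
  have hαβ : β * δ * (α / δ) = α * β := by field_simp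
  simp only [qRacahPoly, div_mul_cancel₀ α hδ, hαβ, mul_comm (qPoch (β * δ * q) q _)]

theorem QRacahAdmissible.symm (h : QRacahAdmissible q N α β γ δ) (hδ : δ ≠ 0) :
    QRacahAdmissible q N (β * δ) (α / δ) γ δ where
  node_injOn := h.node_injOn
  weight_ne_zero := (qRacahWeight_symm q α β γ hδ).symm ▸ h.weight_ne_zero
  param_ne := by
    rw [show β * δ * (α / δ) = α * β by field_simp]
    exact h.param_ne

theorem QRacahPositive.symm (h : QRacahPositive q N α β γ δ) (hδ : δ ≠ 0) :
    QRacahPositive q N (β * δ) (α / δ) γ δ where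
  weight_pos := (qRacahWeight_symm q α β γ hδ).symm ▸ h.weight_pos
  node_lt := h.node_lt

end Symmetry

theorem theorem3p3_general (q : ℝ) (hq : q ≠ 0) (N n k : ℕ) (hkn : k < n) (hnN : n ≤ N) :
    (∀ α β γ δ : ℝ, α = q ^ (-(N : ℤ) - 1) → QRacahAdmissible q N α β γ δ →
      IsWeakQuasiOrthogonal N (qRacahNode q γ δ) (qRacahWeight q α β γ δ) n k
          (qRacahPoly q n (α / q ^ k) β γ δ) ∧
      (β * q ^ n ≠ 1 →
        IsDiscreteQuasiOrthogonal N (qRacahNode q γ δ) (qRacahWeight q α β γ δ) n k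
          (qRacahPoly q n (α / q ^ k) β γ δ)) ∧
      (QRacahPositive q N α β γ δ →
        n - k ≤ numZerosIoo (qRacahPoly q n (α / q ^ k) β γ δ)
          (qRacahNode q γ δ 0) (qRacahNode q γ δ N))) ∧
    (∀ α β γ δ : ℝ, δ ≠ 0 → β = q ^ (-(N : ℤ) - 1) / δ → QRacahAdmissible q N α β γ δ →
      IsWeakQuasiOrthogonal N (qRacahNode q γ δ) (qRacahWeight q α β γ δ) n k
          (qRacahPoly q n α (β / q ^ k) γ δ) ∧
      (α * q ^ n ≠ δ →
        IsDiscreteQuasiOrthogonal N (qRacahNode q γ δ) (qRacahWeight q α β γ δ) n k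
          (qRacahPoly q n α (β / q ^ k) γ δ)) ∧
      (QRacahPositive q N α β γ δ →
        n - k ≤ numZerosIoo (qRacahPoly q n α (β / q ^ k) γ δ)
          (qRacahNode q γ δ 0) (qRacahNode q γ δ N))) := by
  have hpow : q ^ (-(N : ℤ) - 1) * q ^ (N + 1) = 1 := by
    rw [← zpow_natCast, ← zpow_add₀ hq, ← zpow_zero q]
    congr 1
    push_cast
    ring
  refine ⟨fun α β γ δ hα h => ?_, fun α β γ δ hδ hβ h => ?_⟩
  · rw [← hα] at hpow
    exact ⟨h.isWeakQuasiOrthogonal_shift hq hpow hkn hnN,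
      h.isDiscreteQuasiOrthogonal_shift hq hpow hkn hnN,
      h.le_numZerosIoo_shift hq hpow hkn hnN⟩
  · rw [← (eq_div_iff hδ).1 hβ] at hpow
    rw [← qRacahWeight_symm q α β γ hδ, ← qRacahPoly_symm q n α (β / q ^ k) γ hδ,
      div_mul_eq_mul_div]
    refine ⟨(h.symm hδ).isWeakQuasiOrthogonal_shift hq hpow hkn hnN, fun hα => ?_, fun hpos =>
      (h.symm hδ).le_numZerosIoo_shift hq hpow hkn hnN (hpos.symm hδ)⟩
    refine (h.symm hδ).isDiscreteQuasiOrthogonal_shift hq hpow hkn hnN fun hone => hα ?_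
    rwa [div_mul_eq_mul_div, div_eq_one_iff_eq hδ] at hone

theorem theorem3p3 (q : ℝ) (hq0 : 0 < q) (hq1 : q < 1) (N n k : ℕ)
    (hk : 1 ≤ k) (hkn : k ≤ n - 1) (hnN : n ≤ N) :
    (∀ α β γ δ : ℝ, α = q ^ (-(N : ℤ) - 1) → QRacahAdmissible q N α β γ δ →
      IsWeakQuasiOrthogonal N (qRacahNode q γ δ) (qRacahWeight q α β γ δ) n k
          (qRacahPoly q n (α / q ^ k) β γ δ) ∧
      (β * q ^ n ≠ 1 →
        IsDiscreteQuasiOrthogonal N (qRacahNode q γ δ) (qRacahWeight q α β γ δ) n k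
          (qRacahPoly q n (α / q ^ k) β γ δ)) ∧
      (QRacahPositive q N α β γ δ →
        n - k ≤ numZerosIoo (qRacahPoly q n (α / q ^ k) β γ δ)
          (qRacahNode q γ δ 0) (qRacahNode q γ δ N))) ∧
    (∀ α β γ δ : ℝ, δ ≠ 0 → β = q ^ (-(N : ℤ) - 1) / δ → QRacahAdmissible q N α β γ δ →
      IsWeakQuasiOrthogonal N (qRacahNode q γ δ) (qRacahWeight q α β γ δ) n k
          (qRacahPoly q n α (β / q ^ k) γ δ) ∧
      (α * q ^ n ≠ δ →
        IsDiscreteQuasiOrthogonal N (qRacahNode q γ δ) (qRacahWeight q α β γ δ) n k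
          (qRacahPoly q n α (β / q ^ k) γ δ)) ∧
      (QRacahPositive q N α β γ δ →
        n - k ≤ numZerosIoo (qRacahPoly q n α (β / q ^ k) γ δ)
          (qRacahNode q γ δ 0) (qRacahNode q γ δ N))) :=
  theorem3p3_general q hq0.ne' N n k (by lia) hnN
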